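/- Let $Q$ be a smooth $n$-dimensional manifold with a smooth Riemannian metric $g=\langle\cdot,\cdot\rangle$ and Levi-Civita connection $\nabla$. Let $V\in C^\infty(Q)$, and let $\mathcal F\subseteq T^*Q$ be a smooth codistribution of rank $m$, so that $\Sigma=(Q,g,V,\mathcal F)$ is a simple mechanical control system (SMCS). A control force is a map $F:TQ\to\mathcal F$ with $F(v_q)\in\mathcal F_q$ for $v_q\in T_qQ$, and the equations of motion are $$\nabla_{\dot q}\dot q=-\operatorname{grad}V_q+F(\dot q)^\sharp .$$ They determine the control-affine system on $TQ$ given by $\Phi(v_q,F_q)=(v_q)^{\mathrm{hor}}+(-\operatorname{grad}V_q+F_q^\sharp)^{\mathrm{ver}}\in T_{v_q}(TQ)$, $F_q\in\mathcal F_q$, where $\mathrm{hor}$ and $\mathrm{ver}$ are the horizontal (with respect to $\nabla$) and vertical lifts at $v_q$. Let $\mathcal U_q=\{v\in T_qQ:\langle F_q;v\rangle=0\ \forall F_q\in\mathcal F_q\}$ be the unactuated distribution, $\mathcal A_q=\mathcal U_q^{\perp}$ the actuated distribution, $\pi_{\mathcal A}:TQ\to TQ$ the orthogonal projection onto $\mathcal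 A$, and $v^{\mathcal A}=\pi_{\mathcal A}(v)$. Let $h_0\in C^\infty(Q)$, let $\kappa$ be a smooth vector field on $Q$, let $\varepsilon>0$, and put $$h(v_q)=h_0(q)-\tfrac{\varepsilon}{2}\,\bigl\|(v_q-\kappa_q)^{\mathcal A}\bigr\|^2,\qquad v_q\in TQ .$$ Write $\dot h(v_q,F_q)=dh_{v_q}\Phi(v_q,F_q)$ and $e_q=v_q-\kappa_q$. Then $h$ is differentiable on $TQ$, and the following hold. 1. For all $q\in Q$, $v_q\in T_qQ$ and $F_q\in\mathcal F_q$, $$\dot h(v_q,F_q)=d(h_0)_q v_q+\varepsilon\bigl\langle e_q^{\mathcal A},\ \nabla_{v_q}\kappa+\operatorname{grad}V_q-(\nabla_{v_q}\pi_{\mathcal A})(e_q)\bigr\rangle-\varepsilon\langle F_q;e_q^{\mathcal A}\rangle,$$ where $\nabla_{v_q}\pi_{\mathcal A}$ is the covariant derivative of $\pi_{\mathcal A}$ as a $(1,1)$-tensor field. 2. If $F$ is a control force and $q(\cdot)$ is a curve with differentiable velocity $\dot q$ that satisfies the equations of motion on an open set $J\subseteq\mathbb R$, then $\frac{d}{dt}h(\dot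 q(t))=\dot h(\dot q(t),F(\dot q(t)))$ for all $t\in J$. 3. For fixed $v_q$, the map $F_q\mapsto\dot h(v_q,F_q)$ is affine on $\mathcal F_q$, with linear part $F_q\mapsto-\varepsilon\langle F_q;e_q^{\mathcal A}\rangle$. -/

import Mathlib

open scoped Manifold ContDiff Bundle
open Bundle

noncomputable section

namespace GeoMech

variable {E : Type*} [NormedAddCommGroup E] [NormedSpace ℝ E]
  {H : Type*} [TopologicalSpace H] {I : ModelWithCorners ℝ E H}
  {Q : Type*} [TopologicalSpace Q] [ChartedSpace H Q] [IsManifold I ∞ Q]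
  [RiemannianBundle (fun q : Q => TangentSpace I q)]
set_option linter.unusedSectionVars false

section
variable [IsContMDiffRiemannianBundle I ∞ E (fun q : Q => TangentSpace I q)]
variable {X Y Z : Π q : Q, TangentSpace I q} {x : Q}
theorem mdiff_inner (hX : MDiffAt (T% X) x) (hY : MDiffAt (T% Y) x) :
    MDiffAt (fun y => inner ℝ (X y) (Y y)) x :=
  MDifferentiableAt.inner_bundle (E := fun q : Q => TangentSpace I q) hX hY

theorem d_inner_add_right (hX : MDiffAt (T% X) x) (hY : MDiffAt (T% Y) x) (hZ : MDiffAt (T% Z) x) :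
    mvfderiv I (fun y => inner ℝ (X y) ((Y + Z) y)) x
      = mvfderiv I (fun y => inner ℝ (X y) (Y y)) x
        + mvfderiv I (fun y => inner ℝ (X y) (Z y)) x := by
  rw [← mvfderiv_fun_add (mdiff_inner hX hY) (mdiff_inner hX hZ)]
  congr 1
  funext y
  exact inner_add_right _ _ _

theorem d_inner_smul_right {f : Q → ℝ} (hf : MDiffAt f x) (hX : MDiffAt (T% X) x)
    (hY : MDiffAt (T% Y) x) :
    mvfderiv I (fun y => inner ℝ (X y) ((f • Y) y)) x
      = f x • mvfderiv I (fun y => inner ℝ (X y) (Y y)) x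
        + (inner ℝ (X x) (Y x) : ℝ) • mvfderiv I f x := by
  have := mvfderiv_fun_mul hf (mdiff_inner hX hY)
  rw [← this]
  congr 1
  funext y
  exact inner_smul_right _ _ _

theorem d_inner_comm (X Y : Π q : Q, TangentSpace I q) :
    (fun y => (inner ℝ (X y) (Y y) : ℝ)) = fun y => inner ℝ (Y y) (X y) := by
  funext y; exact real_inner_comm _ _

theorem d_inner_add_left (hX : MDiffAt (T% X) x) (hY : MDiffAt (T% Y) x) (hZ : MDiffAt (T% Z) x) :
    mvfderiv I (fun y => inner ℝ ((Y + Z) y) (X y)) x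
      = mvfderiv I (fun y => inner ℝ (Y y) (X y)) x
        + mvfderiv I (fun y => inner ℝ (Z y) (X y)) x := by
  rw [d_inner_comm (Y + Z), d_inner_comm Y, d_inner_comm Z, d_inner_add_right hX hY hZ]

theorem d_inner_smul_left {f : Q → ℝ} (hf : MDiffAt f x) (hX : MDiffAt (T% X) x)
    (hY : MDiffAt (T% Y) x) :
    mvfderiv I (fun y => inner ℝ ((f • Y) y) (X y)) x
      = f x • mvfderiv I (fun y => inner ℝ (Y y) (X y)) x
        + (inner ℝ (Y x) (X x) : ℝ) • mvfderiv I f x := by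
  rw [d_inner_comm (f • Y), d_inner_comm Y, d_inner_smul_right hf hX hY,
    real_inner_comm (X x) (Y x)]

variable (I) in
/-- The Koszul expression of a Riemannian metric: for the Levi-Civita connection `∇` it equals
`2 ⟨∇_X Y, Z⟩`. -/
def koszul (X Y Z : Π q : Q, TangentSpace I q) (x : Q) : ℝ :=
  mvfderiv I (fun y => inner ℝ (Y y) (Z y)) x (X x)
    + mvfderiv I (fun y => inner ℝ (Z y) (X y)) x (Y x)
    - mvfderiv I (fun y => inner ℝ (X y) (Y y)) x (Z x)
    + inner ℝ (VectorField.mlieBracket I X Y x) (Z x)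
    - inner ℝ (VectorField.mlieBracket I Y Z x) (X x)
    + inner ℝ (VectorField.mlieBracket I Z X x) (Y x)

variable [FiniteDimensional ℝ E]
theorem koszul_tensorial_left 
    (hY : MDiffAt (T% Y) x) (hZ : MDiffAt (T% Z) x) :
    TensorialAt I E (fun X => koszul I X Y Z x) x where
  smul {f X} hf hX := by
    have h1 := VectorField.mlieBracket_smul_left (W := Y) hf hX
    have h2 := VectorField.mlieBracket_smul_right (V := Z) hf hX
    simp only [koszul, h1, h2, d_inner_smul_right hf hZ hX, d_inner_smul_left hf hY hX]
    simp only [Pi.smul_apply', add_apply, smul_apply, map_smul, inner_add_left, real_inner_smul_left, real_inner_smul_right, smul_eq_mul, neg_smul, inner_neg_left]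
    rw [real_inner_comm (X x) (Z x)]
    ring
  add {X X'} hX hX' := by
    have h1 := VectorField.mlieBracket_add_left (W := Y) hX hX'
    have h2 := VectorField.mlieBracket_add_right (V := Z) hX hX'
    simp only [koszul, h1, h2, d_inner_add_right hZ hX hX', d_inner_add_left hY hX hX']
    simp only [Pi.add_apply, add_apply, map_add, inner_add_left, inner_add_right]
    ring

theorem koszul_tensorial_right
    (hX : MDiffAt (T% X) x) (hY : MDiffAt (T% Y) x) :
    TensorialAt I E (fun Z => koszul I X Y Z x) x where
  smul {f Z} hf hZ := by
    have h1 := VectorField.mlieBracket_smul_left (W := X) hf hZ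
    have h2 := VectorField.mlieBracket_smul_right (V := Y) hf hZ
    simp only [koszul, h1, h2, d_inner_smul_right hf hY hZ, d_inner_smul_left hf hX hZ]
    simp only [Pi.smul_apply', add_apply, smul_apply, map_smul, inner_add_left, real_inner_smul_left, real_inner_smul_right, smul_eq_mul, neg_smul, inner_neg_left]
    rw [real_inner_comm (Y x) (Z x)]
    ring
  add {Z Z'} hZ hZ' := by
    have h1 := VectorField.mlieBracket_add_left (W := X) hZ hZ'
    have h2 := VectorField.mlieBracket_add_right (V := Y) hZ hZ'
    simp only [koszul, h1, h2, d_inner_add_right hY hZ hZ', d_inner_add_left hX hZ hZ']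
    simp only [Pi.add_apply, add_apply, map_add, inner_add_left, inner_add_right]
    ring

theorem koszul_add 
    (hX : MDiffAt (T% X) x) (hY : MDiffAt (T% Y) x) {Y' : Π q : Q, TangentSpace I q}
    (hY' : MDiffAt (T% Y') x) (hZ : MDiffAt (T% Z) x) :
    koszul I X (Y + Y') Z x = koszul I X Y Z x + koszul I X Y' Z x := by
  have h1 := VectorField.mlieBracket_add_left (W := Z) hY hY'
  have h2 := VectorField.mlieBracket_add_right (V := X) hY hY'
  simp only [koszul, h1, h2, d_inner_add_right hX hY hY', d_inner_add_left hZ hY hY']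
  simp only [Pi.add_apply, add_apply, map_add, inner_add_left, inner_add_right]
  ring

theorem koszul_leibniz {f : Q → ℝ} (hf : MDiffAt f x)
    (hX : MDiffAt (T% X) x) (hY : MDiffAt (T% Y) x) (hZ : MDiffAt (T% Z) x) :
    koszul I X (f • Y) Z x
      = f x * koszul I X Y Z x + 2 * (mvfderiv I f x (X x) * inner ℝ (Y x) (Z x)) := by
  have h1 := VectorField.mlieBracket_smul_left (W := Z) hf hY
  have h2 := VectorField.mlieBracket_smul_right (V := X) hf hY
  simp only [koszul, h1, h2, d_inner_smul_right hf hX hY, d_inner_smul_left hf hZ hY]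
  simp only [Pi.smul_apply', add_apply, smul_apply, map_smul, inner_add_left, real_inner_smul_left, real_inner_smul_right, smul_eq_mul, neg_smul, inner_neg_left]
  rw [real_inner_comm (X x) (Y x)]
  ring

instance finiteDimensional_tangentSpace (q : Q) : FiniteDimensional ℝ (TangentSpace I q) :=
  inferInstanceAs (FiniteDimensional ℝ E)

/-- The cotangent-tangent isomorphism `♯` given by the metric: `⟨η♯, v⟩ = η v`. -/
def sharp {q : Q} (η : TangentSpace I q →L[ℝ] ℝ) : TangentSpace I q :=
  haveI := FiniteDimensional.complete ℝ (TangentSpace I q)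
  (InnerProductSpace.toDual ℝ (TangentSpace I q)).symm η

theorem inner_sharp {q : Q} (η : TangentSpace I q →L[ℝ] ℝ) (v : TangentSpace I q) :
    inner ℝ (sharp η) v = η v :=
  haveI := FiniteDimensional.complete ℝ (TangentSpace I q)
  InnerProductSpace.toDual_symm_apply

open Classical in
variable (I) in
/-- The Levi-Civita derivative `v ↦ (∇_v Y)(x)` of a vector field `Y`, given by the Koszul formula
(with value `0` where `Y` is not differentiable). -/
def leviCivitaFun (Y : Π q : Q, TangentSpace I q) (x : Q) :
    TangentSpace I x →L[ℝ] TangentSpace I x :=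
  if hY : MDiffAt (T% Y) x then
    LinearMap.toContinuousLinearMap
      { toFun := fun v => sharp ((2⁻¹ : ℝ) •
          TensorialAt.mkHom₂ (I := I) (F := E) (F' := E) (fun X Z => koszul I X Y Z x) x
            (fun _ hZ => koszul_tensorial_left hY hZ)
            (fun _ hX => koszul_tensorial_right hX hY) v)
        map_add' := fun v w => by
          refine ext_inner_right ℝ fun u => ?_
          rw [inner_add_left]
          simp only [inner_sharp, map_add, smul_apply, add_apply, smul_add]
        map_smul' := fun c v => by
          refine ext_inner_right ℝ fun u => ?_
          rw [real_inner_smul_left]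
          simp only [inner_sharp, map_smul, smul_apply, RingHom.id_apply, smul_eq_mul]
          ring }
  else 0

theorem leviCivitaFun_inner (hX : MDiffAt (T% X) x) (hY : MDiffAt (T% Y) x) 
    (hZ : MDiffAt (T% Z) x) :
    2 * inner ℝ (leviCivitaFun I Y x (X x)) (Z x) = koszul I X Y Z x := by
  rw [leviCivitaFun, dif_pos hY]
  change 2 * inner ℝ (sharp ((2⁻¹ : ℝ) • _)) (Z x) = _
  rw [inner_sharp, smul_apply, TensorialAt.mkHom₂_apply _ _ hX hZ, smul_eq_mul]
  ring

theorem ext_koszul {A B : TangentSpace I x →L[ℝ] TangentSpace I x}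
    (h : ∀ X Z : Π q : Q, TangentSpace I q, MDiffAt (T% X) x → MDiffAt (T% Z) x →
      2 * inner ℝ (A (X x)) (Z x) = 2 * (inner ℝ (B (X x)) (Z x) : ℝ)) : A = B := by
  ext v
  refine ext_inner_right ℝ fun u => ?_
  have := h (FiberBundle.extend E v) (FiberBundle.extend E u)
    (FiberBundle.mdifferentiableAt_extend ..) (FiberBundle.mdifferentiableAt_extend ..)
  simp only [FiberBundle.extend_apply_self] at this
  linarith

variable (I Q) in
/-- The Levi-Civita connection of the Riemannian manifold `Q`. In Mathlib's argument order
`leviCivita I Q Y x v` is `(∇_v Y)(x)`. -/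
def leviCivita : CovariantDerivative I E (TangentSpace I : Q → Type _) where
  toFun := leviCivitaFun I
  isCovariantDerivativeOnUniv :=
    { add := fun {Y Y' x} hY hY' _ => by
        refine ext_koszul fun X Z hX hZ => ?_
        have h := mdifferentiableAt_add_section hY hY'
        rw [add_apply, inner_add_left, mul_add, leviCivitaFun_inner hX h hZ,
          leviCivitaFun_inner hX hY hZ, leviCivitaFun_inner hX hY' hZ, koszul_add hX hY hY' hZ]
      leibniz := fun {Y f x} hY hf _ => by
        refine ext_koszul fun X Z hX hZ => ?_
        have h := hf.smul_section hY
        rw [leviCivitaFun_inner hX h hZ, koszul_leibniz hf hX hY hZ,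
          ← leviCivitaFun_inner hX hY hZ]
        simp only [add_apply, smul_apply, inner_add_left, real_inner_smul_left,
          ContinuousLinearMap.smulRight_apply]
        ring }

/-- The Levi-Civita connection is compatible with the metric. -/
theorem leviCivita_inner (hX : MDiffAt (T% X) x) (hY : MDiffAt (T% Y) x)
    (hZ : MDiffAt (T% Z) x) :
    mvfderiv I (fun y => inner ℝ (Y y) (Z y)) x (X x)
      = (inner ℝ (leviCivita I Q Y x (X x)) (Z x) : ℝ)
        + inner ℝ (Y x) (leviCivita I Q Z x (X x)) := by
  have h1 := leviCivitaFun_inner hX hY hZ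
  have h2 := leviCivitaFun_inner hX hZ hY
  rw [real_inner_comm] at h2
  change _ = (inner ℝ (leviCivitaFun I Y x (X x)) (Z x) : ℝ) + inner ℝ (Y x) (leviCivitaFun I Z x (X x))
  simp only [koszul] at h1 h2
  rw [d_inner_comm Z X] at h1
  rw [d_inner_comm Z Y, d_inner_comm Y X, VectorField.mlieBracket_swap_apply (V := X) (W := Z),
    VectorField.mlieBracket_swap_apply (V := Z) (W := Y),
    VectorField.mlieBracket_swap_apply (V := Y) (W := X)] at h2
  simp only [inner_neg_left] at h2
  linarith

/-- The Levi-Civita connection is torsion-free. -/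
theorem leviCivita_torsion : (leviCivita I Q).torsion = 0 := by
  rw [CovariantDerivative.torsion_eq_zero_iff]
  intro X Y x hX hY
  refine ext_inner_right ℝ fun u => ?_
  have hZ := FiberBundle.mdifferentiableAt_extend I E u
  have h1 := leviCivitaFun_inner hX hY hZ
  have h2 := leviCivitaFun_inner hY hX hZ
  change inner ℝ (leviCivitaFun I Y x (X x) - leviCivitaFun I X x (Y x)) u = _
  rw [inner_sub_left]
  set Z := FiberBundle.extend E u with hZd
  have hu : Z x = u := by simp [hZd]
  rw [hu] at h1 h2
  simp only [koszul] at h1 h2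
  rw [d_inner_comm Z X] at h1
  rw [d_inner_comm Z Y, d_inner_comm Y X, VectorField.mlieBracket_swap_apply (V := X) (W := Z),
    VectorField.mlieBracket_swap_apply (V := Z) (W := Y),
    VectorField.mlieBracket_swap_apply (V := Y) (W := X)] at h2
  simp only [inner_neg_left, hu] at h1 h2
  linarith

/-- The Riemannian gradient. -/
def grad (f : Q → ℝ) (q : Q) : TangentSpace I q := sharp (mvfderiv I f q)

/-- A local extension of a covector at `q` to a covector field, smooth near `q`. -/
def extendCovector {q : Q} (η : TangentSpace I q →L[ℝ] ℝ) :
    Π y : Q, TangentSpace I y →L[ℝ] ℝ :=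
  FiberBundle.extend (E →L[ℝ] ℝ)
    (E := fun y : Q => TangentSpace I y →L[ℝ] Bundle.Trivial Q ℝ y) η

/-- The covariant derivative of a covector field: `(∇_v η)(w) = v(η(Y)) - η(∇_v Y)`, where `Y` is a local
extension of `w`. -/
def covDerivCovector (η : Π y : Q, TangentSpace I y →L[ℝ] ℝ) (q : Q) (v w : TangentSpace I q) : ℝ :=
  mvfderiv I (fun y => η y (FiberBundle.extend E w y)) q v
    - η q (leviCivita I Q (FiberBundle.extend E w) q v)

/-- The covariant derivative of a bundle map `A : TQ → TQ` seen as the (1,1)-tensor field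
`A(η, w) = η (A w)`:
`(∇_v A)(η, w) = v(A(η, Y)) - A(∇_v η, w) - A(η, ∇_v Y)`, where `η`, `Y` also denote local extensions
of the covector `η` and of the vector `w`. -/
def covDerivTensor (A : Π y : Q, TangentSpace I y →L[ℝ] TangentSpace I y) (q : Q)
    (v : TangentSpace I q) (η : TangentSpace I q →L[ℝ] ℝ) (w : TangentSpace I q) : ℝ :=
  mvfderiv I (fun y => extendCovector η y (A y (FiberBundle.extend E w y))) q v
    - covDerivCovector (extendCovector η) q v (A q w)
    - η (A q (leviCivita I Q (FiberBundle.extend E w) q v))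

/-- The covariant derivative `∇_v A` of a (1,1)-tensor field, as a map on the tangent space at `q`:
the vector `(∇_v A)(w)` is the one with `η ((∇_v A)(w)) = (∇_v A)(η, w)` for all covectors `η`, written
out in a basis. -/
def covDerivEnd (A : Π y : Q, TangentSpace I y →L[ℝ] TangentSpace I y) (q : Q)
    (v w : TangentSpace I q) : TangentSpace I q :=
  let b := Module.finBasis ℝ (TangentSpace I q)
  ∑ i, covDerivTensor A q v (LinearMap.toContinuousLinearMap (b.coord i)) w • b i

variable (I Q) in
/-- A simple mechanical control system on the Riemannian manifold `Q`, whose metric is the kinetic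
energy metric: a smooth potential `V` and a smooth codistribution `inputs` of rank `m`, i.e. a
choice of subspaces of the cotangent spaces that is locally spanned by `m` smooth, pointwise
linearly independent covector fields. -/
structure SMCS (m : ℕ) where
  V : Q → ℝ
  contMDiff_V : ContMDiff I 𝓘(ℝ, ℝ) ∞ V
  inputs : Π q : Q, Submodule ℝ (TangentSpace I q →L[ℝ] ℝ)
  exists_frame : ∀ q₀ : Q, ∃ U : Set Q, IsOpen U ∧ q₀ ∈ U ∧
    ∃ η : Fin m → Π q : Q, TangentSpace I q →L[ℝ] ℝ,
      (∀ i, ContMDiffOn I (I.prod 𝓘(ℝ, E →L[ℝ] ℝ)) ∞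
        (fun q => TotalSpace.mk' (E →L[ℝ] ℝ)
          (E := fun y : Q => TangentSpace I y →L[ℝ] Bundle.Trivial Q ℝ y) q (η i q)) U) ∧
      ∀ q ∈ U, LinearIndependent ℝ (fun i => η i q) ∧
        Submodule.span ℝ (Set.range fun i => η i q) = inputs q

namespace SMCS
variable {m : ℕ} (S : SMCS I Q m)

/-- The unactuated distribution, the coannihilator of the input codistribution. -/
def unactuated (q : Q) : Submodule ℝ (TangentSpace I q) where
  carrier := {v | ∀ F ∈ S.inputs q, F v = 0}
  add_mem' := fun {v w} hv hw F hF => by rw [map_add, hv F hF, hw F hF, add_zero]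
  zero_mem' := fun F _ => map_zero F
  smul_mem' := fun c v hv F hF => by rw [map_smul, hv F hF, smul_zero]

/-- The actuated distribution, the orthogonal complement of the unactuated one. -/
def actuated (q : Q) : Submodule ℝ (TangentSpace I q) := (S.unactuated q)ᗮ

/-- The projection `v ↦ v^A` onto the actuated distribution along the unactuated one. -/
def projA (q : Q) : TangentSpace I q →L[ℝ] TangentSpace I q :=
  (S.actuated q).starProjection

/-- The backstepping candidate `h(v_q) = h₀(q) - (ε / 2) ‖(v_q - κ_q)^A‖²` on `TQ`. -/
def candidate (h₀ : Q → ℝ) (κ : Π q : Q, TangentSpace I q) (ε : ℝ) (p : TangentBundle I Q) : ℝ :=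
  h₀ p.proj - ε / 2 * ‖S.projA p.proj (p.snd - κ p.proj)‖ ^ 2

end SMCS

/-- The vertical lift of `w ∈ T_q Q` to `T_p(TQ)`, `p = (q, v)`: the velocity at `t = 0` of the curve
`t ↦ v + t w` in the fibre `T_q Q`. -/
def verticalLift (p : TangentBundle I Q) (w : TangentSpace I p.proj) :
    TangentSpace I.tangent p :=
  mfderiv 𝓘(ℝ, ℝ) I.tangent (fun t : ℝ => (⟨p.proj, p.snd + t • w⟩ : TangentBundle I Q)) 0 (1 : ℝ)

/-- The horizontal lift of `w ∈ T_q Q` to `T_p(TQ)`, `p = (q, v)`: `dσ(w) - (∇_w σ)^ver` for a local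
vector field `σ` with `σ(q) = v`. -/
def horizontalLift (p : TangentBundle I Q) (w : TangentSpace I p.proj) :
    TangentSpace I.tangent p :=
  let dσ : TangentSpace I.tangent p :=
    mfderiv I I.tangent
      (fun y => (⟨y, FiberBundle.extend E p.snd y⟩ : TangentBundle I Q)) p.proj w
  dσ - verticalLift p (leviCivita I Q (FiberBundle.extend E p.snd) p.proj w)

namespace SMCS
variable {m : ℕ} (S : SMCS I Q m)
/-- The control-affine dynamics on `TQ` induced by `∇_{q'} q' = -grad V + F♯`: the
geodesic spray (the horizontal lift of `v` at `v`) plus the vertical lift of `-grad V + F♯`. -/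
def dynamics (p : TangentBundle I Q) (F : S.inputs p.proj) : TangentSpace I.tangent p :=
  horizontalLift p p.snd + verticalLift p (- grad S.V p.proj + sharp F.1)

/-- `ḣ(v_q, F_q) = dh (Φ(v_q, F_q))`, the derivative of the candidate along the dynamics. -/
def hDot (h₀ : Q → ℝ) (κ : Π q : Q, TangentSpace I q) (ε : ℝ) (p : TangentBundle I Q)
    (F : S.inputs p.proj) : ℝ :=
  mvfderiv I.tangent (S.candidate h₀ κ ε) p (S.dynamics p F)
end SMCS

variable (I) in
/-- The velocity curve `t ↦ q'(t) ∈ T_{q(t)} Q` of a curve, as a curve in `TQ`. -/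
def velocity (γ : ℝ → Q) (t : ℝ) : TangentBundle I Q :=
  ⟨γ t, mfderiv 𝓘(ℝ, ℝ) I γ t (1 : ℝ)⟩

/-- The covariant derivative along a curve `γ` of a vector field `W` along `γ`. In the local frame
`(E_i)` given by the trivialization of `TQ` at `γ t` one has `W = ∑ W^i E_i`, and the derivative
at `t` is `∑ (W^i)' E_i + ∑ W^i ∇_{γ'} E_i`. -/
def covDerivAlong (γ : ℝ → Q) (W : Π t : ℝ, TangentSpace I (γ t)) (t : ℝ) :
    TangentSpace I (γ t) :=
  (trivializationAt E (TangentSpace I) (γ t)).symm (γ t)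
      (deriv (fun s => (trivializationAt E (TangentSpace I) (γ t) ⟨γ s, W s⟩).2) t)
    + leviCivita I Q (FiberBundle.extend E (W t)) (γ t) (velocity I γ t).snd

namespace SMCS
variable {m : ℕ} (S : SMCS I Q m)
/-- A control force: a fibre-preserving map from `TQ` to the input codistribution. -/
abbrev ControlForce : Type _ := Π p : TangentBundle I Q, S.inputs p.proj

/-- The curve `γ` satisfies the equations of motion `∇_{γ'} γ' = -grad V + F(γ')♯` on `J`. -/
structure IsSolutionOn (F : S.ControlForce) (γ : ℝ → Q) (J : Set ℝ) : Prop where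
  mdifferentiableAt : ∀ t ∈ J, MDifferentiableAt 𝓘(ℝ, ℝ) I γ t
  mdifferentiableAt_velocity : ∀ t ∈ J, MDifferentiableAt 𝓘(ℝ, ℝ) I.tangent (velocity I γ) t
  eom : ∀ t ∈ J, covDerivAlong γ (fun s => (velocity I γ s).snd) t
    = - grad S.V (γ t)
      + sharp (F (velocity I γ t)).1
end SMCS
end
end GeoMech

end

open GeoMech

/-! Write `a` for the actuated part of `e = v - κ`. Everything comes down to differentiating the
candidate in two kinds of directions of `T(TQ)`. Vertical: on a fibre the candidate is a quadratic
polynomial, so its differential on the vertical lift of `w` is `-ε ⟨a, w⟩`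
(`mvfderiv_candidate_verticalLift`). Along a local vector field `σ` with `σ(q) = v`: metric
compatibility of `∇` and the Leibniz rule `∇_v (π_A (σ - κ)) = (∇_v π_A)(e) + π_A (∇_v σ - ∇_v κ)`,
with `π_A` a self-adjoint idempotent, give `dh₀ v - ε ⟨a, (∇_v π_A)(e) + ∇_v σ - ∇_v κ⟩`
(`mvfderiv_candidate_section`).

The horizontal lift of `v` is `dσ(v)` minus the vertical lift of `∇_v σ`, so the terms in `∇_v σ`
cancel; adding the vertical lift of `-grad V + F♯` gives the formula (`hDot_eq`). It depends on `F`
only through a linear term, hence the affine claim.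

For a curve in `TQ`, a local trivialization splits the derivative of the candidate into the
derivative along `σ` and a vertical part given by the derivative of the fibre coordinate
(`hasDerivAt_comp_curve`). The equations of motion identify that coordinate derivative plus `∇_v σ`
with `-grad V + F♯`, and the same expression results.

Differentiability of the candidate and of `π_A` is obtained from local orthonormal frames of the
actuated distribution, built by Gram-Schmidt from the metric duals of a frame of the codistribution.
-/

noncomputable section

namespace GeoMech

open InnerProductSpace
open scoped Topology

set_option linter.unusedSectionVars false

variable {E : Type*} [NormedAddCommGroup E] [NormedSpace ℝ E]
  {H : Type*} [TopologicalSpace H] {I : ModelWithCorners ℝ E H}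
  {Q : Type*} [TopologicalSpace Q] [ChartedSpace H Q] [IsManifold I ∞ Q]
  [RiemannianBundle (fun q : Q => TangentSpace I q)]
  [IsContMDiffRiemannianBundle I ∞ E (fun q : Q => TangentSpace I q)]

/-! ### Gram-Schmidt for vector fields -/

section frames
variable {ι : Type*} [LinearOrder ι] [LocallyFiniteOrderBot ι] [WellFoundedLT ι]
  {s : ι → Π q : Q, TangentSpace I q} {x : Q}

/-- Gram-Schmidt orthogonalisation preserves differentiability of vector fields. -/
theorem mdifferentiableAt_gramSchmidt (hs : ∀ i, MDiffAt (T% (s i)) x)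
    (hli : LinearIndependent ℝ (fun i => s i x)) (i : ι) :
    MDiffAt (T% (fun y => gramSchmidt ℝ (fun j => s j y) i)) x := by
  induction i using WellFoundedLT.induction with
  | ind i ih =>
    -- Squared norms are written as inner products so that `mdiff_inner` applies to numerator and
    -- denominator alike.
    have key : (fun y => gramSchmidt ℝ (fun j => s j y) i)
        = s i - (fun y => ∑ j ∈ Finset.Iio i,
          ((inner ℝ (gramSchmidt ℝ (fun k => s k y) j) (s i y) : ℝ)
            / inner ℝ (gramSchmidt ℝ (fun k => s k y) j) (gramSchmidt ℝ (fun k => s k y) j))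
            • gramSchmidt ℝ (fun k => s k y) j) := by
      funext y
      have h := gramSchmidt_def'' ℝ (fun k => s k y) i
      rw [Pi.sub_apply, eq_sub_iff_add_eq]
      simp only [real_inner_self_eq_norm_sq]
      exact h.symm
    refine MDifferentiableAt.congr_of_eventuallyEq (mdifferentiableAt_sub_section (hs i) ?_)
      (Filter.Eventually.of_forall fun y => TotalSpace.mk_inj.mpr (congrFun key y))
    refine MDifferentiableAt.sum_section fun j hj => ?_
    have hj' := ih j (Finset.mem_Iio.mp hj)
    -- Independence at the single point `x` suffices: the quotient need only have a nonzero
    -- denominator there.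
    have hne : (inner ℝ (gramSchmidt ℝ (fun k => s k x) j) (gramSchmidt ℝ (fun k => s k x) j) : ℝ)
        ≠ 0 := by
      rw [inner_self_ne_zero]
      exact gramSchmidt_ne_zero j hli
    refine MDifferentiableAt.smul_section ?_ hj'
    have h1 := mdiff_inner hj' (hs i)
    have h2 := mdiff_inner hj' hj'
    simp only [div_eq_mul_inv]
    exact h1.mul ((differentiableAt_inv hne).mdifferentiableAt.comp x h2)

theorem mdifferentiableAt_gramSchmidtNormed (hs : ∀ i, MDiffAt (T% (s i)) x)
    (hli : LinearIndependent ℝ (fun i => s i x)) (i : ι) :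
    MDiffAt (T% (fun y => gramSchmidtNormed ℝ (fun j => s j y) i)) x := by
  have h := mdifferentiableAt_gramSchmidt hs hli i
  have hne : (inner ℝ (gramSchmidt ℝ (fun k => s k x) i) (gramSchmidt ℝ (fun k => s k x) i) : ℝ)
      ≠ 0 := by
    rw [inner_self_ne_zero]
    exact gramSchmidt_ne_zero i hli
  have key : (fun y => gramSchmidtNormed ℝ (fun j => s j y) i)
      = fun y => (√(inner ℝ (gramSchmidt ℝ (fun k => s k y) i)
          (gramSchmidt ℝ (fun k => s k y) i)))⁻¹ • gramSchmidt ℝ (fun j => s j y) i := by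
    funext y
    rw [gramSchmidtNormed, real_inner_self_eq_norm_sq, Real.sqrt_sq (norm_nonneg _)]
    rfl
  have h2 := mdiff_inner h h
  have h3 : DifferentiableAt ℝ (fun r : ℝ => (√r)⁻¹)
      (inner ℝ (gramSchmidt ℝ (fun k => s k x) i) (gramSchmidt ℝ (fun k => s k x) i)) :=
    (differentiableAt_id.sqrt hne).inv
      (Real.sqrt_ne_zero'.mpr (lt_of_le_of_ne real_inner_self_nonneg hne.symm))
  have h4 : MDiffAt (fun y => (√(inner ℝ (gramSchmidt ℝ (fun k => s k y) i)
      (gramSchmidt ℝ (fun k => s k y) i)))⁻¹) x :=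
    MDifferentiableAt.comp (g := fun r : ℝ => (√r)⁻¹) x h3.mdifferentiableAt h2
  exact MDifferentiableAt.congr_of_eventuallyEq (h4.smul_section h)
    (Filter.Eventually.of_forall fun y => TotalSpace.mk_inj.mpr (congrFun key y))

end frames

/-! ### Orthonormal local frames and metric duals -/

section
variable [FiniteDimensional ℝ E]

/-- Gram-Schmidt applied to the coordinate frame of a trivialization keeps the span, hence still
spans every tangent space. -/
theorem exists_orthonormal_localFrame (x : Q) :
    ∃ (k : ℕ) (e : Fin k → Π q : Q, TangentSpace I q), ∃ U : Set Q, IsOpen U ∧ x ∈ U ∧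
      (∀ i, ∀ y ∈ U, MDiffAt (T% (e i)) y) ∧ ∀ y ∈ U, Orthonormal ℝ (fun i => e i y) ∧
        ∀ w : TangentSpace I y, w ∈ Submodule.span ℝ (Set.range fun i => e i y) := by
  let t := trivializationAt E (TangentSpace I) x
  let b := Module.finBasis ℝ E
  have ht : ∀ y ∈ t.baseSet, LinearIndependent ℝ (fun i => t.localFrame b i y) :=
    fun y hy => (t.isLocalFrameOn_localFrame_baseSet I 1 b).linearIndependent hy
  refine ⟨_, fun i y => gramSchmidtNormed ℝ (fun j => t.localFrame b j y) i, t.baseSet,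
    t.open_baseSet, FiberBundle.mem_baseSet_trivializationAt' x, fun i y hy => ?_,
    fun y hy => ⟨gramSchmidtNormed_orthonormal (ht y hy), fun w => ?_⟩⟩
  · exact mdifferentiableAt_gramSchmidtNormed (fun j =>
      (contMDiffAt_localFrame_of_mem 1 t b j hy).mdifferentiableAt one_ne_zero) (ht y hy) i
  · rw [span_gramSchmidtNormed_range, span_gramSchmidt]
    exact (t.isLocalFrameOn_localFrame_baseSet I 1 b).generating hy trivial

/-- A differentiable covector field applied to a differentiable vector field. -/
theorem mdifferentiableAt_covector_apply {η : Π y : Q, TangentSpace I y →L[ℝ] ℝ}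
    {Y : Π q : Q, TangentSpace I q} {x : Q}
    (hη : MDifferentiableAt I (I.prod 𝓘(ℝ, E →L[ℝ] ℝ))
      (fun q => TotalSpace.mk' (E →L[ℝ] ℝ)
        (E := fun y : Q => TangentSpace I y →L[ℝ] Bundle.Trivial Q ℝ y) q (η q)) x)
    (hY : MDiffAt (T% Y) x) : MDiffAt (fun y => η y (Y y)) x := by
  have h := MDifferentiableAt.clm_bundle_apply (F₁ := E) (F₂ := ℝ) (E₂ := Bundle.Trivial Q ℝ)
    (b := id) hη hY
  rw [mdifferentiableAt_totalSpace] at h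
  exact h.2

theorem sum_inner_smul_of_orthonormal {F ι : Type*} [NormedAddCommGroup F] [InnerProductSpace ℝ F]
    [Fintype ι] {e : ι → F} (he : Orthonormal ℝ e) {w : F}
    (hw : w ∈ Submodule.span ℝ (Set.range e)) : ∑ i, (inner ℝ (e i) w : ℝ) • e i = w := by
  classical
  induction hw using Submodule.span_induction with
  | mem w h =>
    obtain ⟨j, rfl⟩ := h
    simp [orthonormal_iff_ite.mp he]
  | zero => simp
  | add v w _ _ hv hw => simp only [inner_add_right, add_smul, Finset.sum_add_distrib, hv, hw]
  | smul c w _ hw => simp only [inner_smul_right, mul_smul, ← Finset.smul_sum, hw]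

/-- The metric dual of a differentiable covector field is differentiable. -/
theorem mdifferentiableAt_sharp {η : Π y : Q, TangentSpace I y →L[ℝ] ℝ} {x : Q}
    (hη : MDifferentiableAt I (I.prod 𝓘(ℝ, E →L[ℝ] ℝ))
      (fun q => TotalSpace.mk' (E →L[ℝ] ℝ)
        (E := fun y : Q => TangentSpace I y →L[ℝ] Bundle.Trivial Q ℝ y) q (η q)) x) :
    MDiffAt (T% (fun y => sharp (η y))) x := by
  obtain ⟨k, e, U, hU, hx, he, hon⟩ := exists_orthonormal_localFrame (I := I) x
  -- In an orthonormal frame the coefficients of `η♯` are `⟨e i, η♯⟩ = η (e i)`, which are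
  -- differentiable functions.
  have h : MDiffAt (T% (fun y => ∑ i, η y (e i y) • e i y)) x :=
    MDifferentiableAt.sum_section fun i _ =>
      (mdifferentiableAt_covector_apply hη (he i x hx)).smul_section (he i x hx)
  refine h.congr_of_eventuallyEq ?_
  filter_upwards [hU.mem_nhds hx] with y hy
  rw [TotalSpace.mk_inj]
  conv_lhs => rw [← sum_inner_smul_of_orthonormal (hon y hy).1 ((hon y hy).2 (sharp (η y)))]
  simp only [real_inner_comm (sharp (η y)), inner_sharp]

/-! ### The actuated distribution and differentiability of the candidate -/

namespace SMCS
variable {m : ℕ} (S : SMCS I Q m)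

/-- A vector is killed by the frame covectors `η i` exactly when it is orthogonal to the vectors `(η
i)♯`. So the unactuated space is the orthogonal complement of their span, and in finite dimension
the double complement returns that span. -/
theorem exists_orthonormal_frame_actuated (x : Q) :
    ∃ (a : Fin m → Π q : Q, TangentSpace I q), ∃ U : Set Q, IsOpen U ∧ x ∈ U ∧
      (∀ i, ∀ y ∈ U, MDiffAt (T% (a i)) y) ∧ ∀ y ∈ U, Orthonormal ℝ (fun i => a i y) ∧
        Submodule.span ℝ (Set.range fun i => a i y) = S.actuated y := by
  obtain ⟨U, hU, hx, η, hη, hspan⟩ := S.exists_frame x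
  have hd : ∀ i, ∀ y ∈ U, MDiffAt (T% (fun z => sharp (η i z))) y := fun i y hy =>
    mdifferentiableAt_sharp (((hη i).contMDiffAt (hU.mem_nhds hy)).mdifferentiableAt (by simp))
  have hli : ∀ y ∈ U, LinearIndependent ℝ (fun i => sharp (η i y)) := fun y hy => by
    have := FiniteDimensional.complete ℝ (TangentSpace I y)
    exact (hspan y hy).1.map'
      (InnerProductSpace.toDual ℝ (TangentSpace I y)).symm.toLinearEquiv.toLinearMap
      (LinearEquiv.ker _)
  refine ⟨fun i y => gramSchmidtNormed ℝ (fun j => sharp (η j y)) i, U, hU, hx,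
    fun i y hy => mdifferentiableAt_gramSchmidtNormed (fun j => hd j y hy) (hli y hy) i,
    fun y hy => ⟨gramSchmidtNormed_orthonormal (hli y hy), ?_⟩⟩
  rw [span_gramSchmidtNormed_range, span_gramSchmidt, actuated]
  have h : S.unactuated y = (Submodule.span ℝ (Set.range fun i => sharp (η i y)))ᗮ := by
    ext v
    rw [Submodule.mem_orthogonal]
    constructor
    · intro hv u hu
      induction hu using Submodule.span_induction with
      | mem u h =>
        obtain ⟨j, rfl⟩ := h
        rw [inner_sharp]
        refine hv _ ?_
        rw [← (hspan y hy).2]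
        exact Submodule.subset_span ⟨j, rfl⟩
      | zero => simp
      | add u w _ _ hu hw => rw [inner_add_left, hu, hw, add_zero]
      | smul c u _ hu => rw [real_inner_smul_left, hu, mul_zero]
    · intro hv F hF
      rw [← (hspan y hy).2] at hF
      induction hF using Submodule.span_induction with
      | mem F h =>
        obtain ⟨j, rfl⟩ := h
        rw [← inner_sharp]
        exact hv _ (Submodule.subset_span ⟨j, rfl⟩)
      | zero => rfl
      | add F G _ _ hF hG => rw [add_apply, hF, hG, add_zero]
      | smul c F _ hF => rw [smul_apply, hF, smul_zero]
  rw [h, Submodule.orthogonal_orthogonal]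

/-- By self-adjointness `⟨a i, π_A w⟩ = ⟨π_A (a i), w⟩ = ⟨a i, w⟩`. This turns the pointwise
projection into an expression whose dependence on the base point can be differentiated. -/
theorem projA_eq_sum {y : Q} {ι : Type*} [Fintype ι] {a : ι → TangentSpace I y}
    (ha : Orthonormal ℝ a) (hspan : Submodule.span ℝ (Set.range a) = S.actuated y)
    (w : TangentSpace I y) : S.projA y w = ∑ i, (inner ℝ (a i) w : ℝ) • a i := by
  rw [← sum_inner_smul_of_orthonormal ha (w := S.projA y w)]
  · refine Finset.sum_congr rfl fun i _ => ?_
    congr 1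
    have hi : a i ∈ S.actuated y := hspan ▸ Submodule.subset_span ⟨i, rfl⟩
    rw [projA, ← Submodule.inner_starProjection_left_eq_right,
      Submodule.starProjection_eq_self_iff.mpr hi]
  · rw [hspan]
    exact Submodule.starProjection_apply_mem _ _

theorem norm_projA_sq {y : Q} {ι : Type*} [Fintype ι] {a : ι → TangentSpace I y}
    (ha : Orthonormal ℝ a) (hspan : Submodule.span ℝ (Set.range a) = S.actuated y)
    (w : TangentSpace I y) : ‖S.projA y w‖ ^ 2 = ∑ i, (inner ℝ (a i) w : ℝ) ^ 2 := by
  rw [S.projA_eq_sum ha hspan, ← real_inner_self_eq_norm_sq, ha.inner_sum]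
  simp [sq]

/-- The projection onto the actuated distribution preserves differentiability of vector fields. -/
theorem mdifferentiableAt_projA {Y : Π q : Q, TangentSpace I q} {x : Q} (hY : MDiffAt (T% Y) x) :
    MDiffAt (T% (fun y => S.projA y (Y y))) x := by
  obtain ⟨a, U, hU, hx, ha, hon⟩ := S.exists_orthonormal_frame_actuated x
  have h : MDiffAt (T% (fun y => ∑ i, (inner ℝ (a i y) (Y y) : ℝ) • a i y)) x :=
    MDifferentiableAt.sum_section fun i _ => (mdiff_inner (ha i x hx) hY).smul_section (ha i x hx)
  refine h.congr_of_eventuallyEq ?_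
  filter_upwards [hU.mem_nhds hx] with y hy
  rw [TotalSpace.mk_inj]
  exact S.projA_eq_sum (hon y hy).1 (hon y hy).2 _

/-- Over the domain of an orthonormal frame `a` of the actuated distribution, the squared norm is
the finite sum of the squares of `⟨a i, v⟩ - ⟨a i, κ⟩`. -/
theorem mdifferentiable_candidate {h₀ : Q → ℝ} (hh₀ : MDiff h₀) {κ : Π q : Q, TangentSpace I q}
    (hκ : MDiff (T% κ)) (ε : ℝ) :
    MDifferentiable I.tangent 𝓘(ℝ, ℝ) (S.candidate h₀ κ ε) := by
  intro p
  obtain ⟨a, U, hU, hx, ha, hon⟩ := S.exists_orthonormal_frame_actuated p.proj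
  have hπ : MDifferentiableAt I.tangent I (fun p : TangentBundle I Q => p.proj) p :=
    Bundle.mdifferentiableAt_proj (TangentSpace I)
  have hinner : ∀ i, MDifferentiableAt I.tangent 𝓘(ℝ, ℝ)
      (fun p : TangentBundle I Q => (inner ℝ (a i p.proj) p.snd : ℝ)) p := fun i => by
    have h1 : MDifferentiableAt I.tangent I.tangent
        (fun p : TangentBundle I Q => (⟨p.proj, a i p.proj⟩ : TangentBundle I Q)) p :=
      MDifferentiableAt.comp p (ha i _ hx) hπ
    -- The tautological section `v ↦ v` along the projection `TQ → Q` is the identity map of `TQ`.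
    have h2 : MDifferentiableAt I.tangent I.tangent
        (fun p : TangentBundle I Q => (⟨p.proj, p.snd⟩ : TangentBundle I Q)) p :=
      mdifferentiableAt_id
    exact MDifferentiableAt.inner_bundle (E := fun q : Q => TangentSpace I q)
      (b := fun p : TangentBundle I Q => p.proj) h1 h2
  have hinner' : ∀ i, MDifferentiableAt I.tangent 𝓘(ℝ, ℝ)
      (fun p : TangentBundle I Q => (inner ℝ (a i p.proj) (κ p.proj) : ℝ)) p := fun i =>
    MDifferentiableAt.comp p (mdiff_inner (ha i _ hx) (hκ p.proj)) hπ
  have hsq : ∀ i, MDifferentiableAt I.tangent 𝓘(ℝ, ℝ) (fun p : TangentBundle I Q =>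
      ((inner ℝ (a i p.proj) p.snd : ℝ) - inner ℝ (a i p.proj) (κ p.proj)) ^ 2) p := fun i => by
    exact ((hinner i).sub (hinner' i)).pow 2
  have h : MDifferentiableAt I.tangent 𝓘(ℝ, ℝ) (fun p : TangentBundle I Q => h₀ p.proj - ε / 2 *
      ∑ i, ((inner ℝ (a i p.proj) p.snd : ℝ) - inner ℝ (a i p.proj) (κ p.proj)) ^ 2) p := by
    have h1 : MDifferentiableAt I.tangent 𝓘(ℝ, ℝ) (fun p : TangentBundle I Q => h₀ p.proj) p :=
      MDifferentiableAt.comp p (hh₀ _) hπ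
    have h2 := MDifferentiableAt.sum (t := Finset.univ) fun i _ => hsq i
    rw [Finset.sum_fn] at h2
    exact h1.sub (mdifferentiableAt_const.mul h2)
  refine h.congr_of_eventuallyEq ?_
  filter_upwards [hπ.continuousAt.preimage_mem_nhds (hU.mem_nhds hx)] with z hz
  rw [candidate, S.norm_projA_sq (hon _ hz).1 (hon _ hz).2]
  simp only [inner_sub_right]

end SMCS

/-! ### Tensoriality and the covariant derivative of a (1,1)-tensor field -/

theorem leviCivita_add {X Y : Π q : Q, TangentSpace I q} {x : Q} (hX : MDiffAt (T% X) x)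
    (hY : MDiffAt (T% Y) x) :
    leviCivita I Q (X + Y) x = leviCivita I Q X x + leviCivita I Q Y x :=
  (leviCivita I Q).isCovariantDerivativeOnUniv.add hX hY

theorem leviCivita_smul {f : Q → ℝ} {Y : Π q : Q, TangentSpace I q} {x : Q} (hf : MDiffAt f x)
    (hY : MDiffAt (T% Y) x) :
    leviCivita I Q (f • Y) x
      = f x • leviCivita I Q Y x + (mvfderiv I f x).smulRight (Y x) :=
  (leviCivita I Q).isCovariantDerivativeOnUniv.leibniz hY hf

theorem leviCivita_neg {Y : Π q : Q, TangentSpace I q} {x : Q} (hY : MDiffAt (T% Y) x) :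
    leviCivita I Q (-Y) x = - leviCivita I Q Y x := by
  have h := (leviCivita I Q).isCovariantDerivativeOnUniv.smul_const (-1 : ℝ) hY
  simpa using! h

theorem leviCivita_sub {X Y : Π q : Q, TangentSpace I q} {x : Q} (hX : MDiffAt (T% X) x)
    (hY : MDiffAt (T% Y) x) :
    leviCivita I Q (X - Y) x = leviCivita I Q X x - leviCivita I Q Y x := by
  rw [sub_eq_add_neg, leviCivita_add hX (mdifferentiableAt_neg_section hY), leviCivita_neg hY,
    sub_eq_add_neg]

/-- `Y ↦ v(η(Y)) - η(∇_v Y)` is tensorial. -/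
theorem tensorialAt_covDerivCovector {η : Π y : Q, TangentSpace I y →L[ℝ] ℝ} {x : Q}
    (hη : MDifferentiableAt I (I.prod 𝓘(ℝ, E →L[ℝ] ℝ))
      (fun q => TotalSpace.mk' (E →L[ℝ] ℝ)
        (E := fun y : Q => TangentSpace I y →L[ℝ] Bundle.Trivial Q ℝ y) q (η q)) x)
    (v : TangentSpace I x) :
    TensorialAt I E (fun Y : Π q : Q, TangentSpace I q =>
      mvfderiv I (fun y => η y (Y y)) x v - η x (leviCivita I Q Y x v)) x where
  smul {f Y} hf hY := by
    have h1 : (fun y => η y ((f • Y) y)) = f * fun y => η y (Y y) := by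
      funext y
      exact map_smul (η y) (f y) (Y y)
    -- Both terms produce `df(v) η(Y)`, and these cancel in the difference.
    rw [h1, mvfderiv_mul hf (mdifferentiableAt_covector_apply hη hY), leviCivita_smul hf hY]
    simp only [add_apply, smul_apply, map_add, map_smul, ContinuousLinearMap.smulRight_apply,
      smul_eq_mul]
    ring
  add {Y Z} hY hZ := by
    have h1 : (fun y => η y ((Y + Z) y)) = (fun y => η y (Y y)) + fun y => η y (Z y) := by
      funext y
      exact map_add (η y) (Y y) (Z y)
    rw [h1, mvfderiv_add (mdifferentiableAt_covector_apply hη hY)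
      (mdifferentiableAt_covector_apply hη hZ), leviCivita_add hY hZ]
    simp only [add_apply, map_add]
    ring

/-- `Y ↦ ∇_v (A Y) - A (∇_v Y)` is tensorial. -/
theorem tensorialAt_leviCivita_commutator {A : Π y : Q, TangentSpace I y →L[ℝ] TangentSpace I y}
    {x : Q} (hA : ∀ Y : Π q : Q, TangentSpace I q, MDiffAt (T% Y) x →
      MDiffAt (T% (fun y => A y (Y y))) x) (v : TangentSpace I x) :
    TensorialAt I E (fun Y : Π q : Q, TangentSpace I q =>
      leviCivita I Q (fun y => A y (Y y)) x v - A x (leviCivita I Q Y x v)) x where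
  smul {f Y} hf hY := by
    have h1 : (fun y => A y ((f • Y) y)) = f • fun y => A y (Y y) := by
      funext y
      exact map_smul (A y) (f y) (Y y)
    rw [h1, leviCivita_smul hf (hA Y hY), leviCivita_smul hf hY]
    simp only [add_apply, smul_apply, map_add, map_smul, ContinuousLinearMap.smulRight_apply,
      smul_sub]
    abel
  add {Y Z} hY hZ := by
    have h1 : (fun y => A y ((Y + Z) y)) = (fun y => A y (Y y)) + fun y => A y (Z y) := by
      funext y
      exact map_add (A y) (Y y) (Z y)
    rw [h1, leviCivita_add (hA Y hY) (hA Z hZ), leviCivita_add hY hZ]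
    simp only [add_apply, map_add]
    abel

theorem mdifferentiableAt_extendCovector {x : Q} (η : TangentSpace I x →L[ℝ] ℝ) :
    MDifferentiableAt I (I.prod 𝓘(ℝ, E →L[ℝ] ℝ))
      (fun q => TotalSpace.mk' (E →L[ℝ] ℝ)
        (E := fun y : Q => TangentSpace I y →L[ℝ] Bundle.Trivial Q ℝ y) q
          (extendCovector η q)) x :=
  FiberBundle.mdifferentiableAt_extend I (E →L[ℝ] ℝ)
    (V := fun y : Q => TangentSpace I y →L[ℝ] Bundle.Trivial Q ℝ y) η

theorem extendCovector_self {x : Q} (η : TangentSpace I x →L[ℝ] ℝ) : extendCovector η x = η :=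
  FiberBundle.extend_apply_self (E →L[ℝ] ℝ)
    (E := fun y : Q => TangentSpace I y →L[ℝ] Bundle.Trivial Q ℝ y) η

/-- The term `(∇_v η)(A w)` is defined through the standard extension of `A w`; by tensoriality the
field `A Y`, with `Y` the extension of `w`, serves as well. The derivatives of `η (A Y)` then
cancel, and `η` acts on a vector. -/
theorem covDerivTensor_eq {A : Π y : Q, TangentSpace I y →L[ℝ] TangentSpace I y}
    {x : Q} (hA : ∀ Y : Π q : Q, TangentSpace I q, MDiffAt (T% Y) x →
      MDiffAt (T% (fun y => A y (Y y))) x) (v w : TangentSpace I x)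
    (η : TangentSpace I x →L[ℝ] ℝ) :
    covDerivTensor A x v η w
      = η (leviCivita I Q (fun y => A y (FiberBundle.extend E w y)) x v
          - A x (leviCivita I Q (FiberBundle.extend E w) x v)) := by
  have hW := FiberBundle.mdifferentiableAt_extend I E w
  have h := (tensorialAt_covDerivCovector (mdifferentiableAt_extendCovector η) v).pointwise
    (hA _ hW) (FiberBundle.mdifferentiableAt_extend I E (A x w))
    (by simp only [FiberBundle.extend_apply_self])
  rw [covDerivTensor, covDerivCovector, ← h, extendCovector_self, map_sub]
  ring

/-- The Leibniz rule `(∇_v A)(Y) = ∇_v (A Y) - A (∇_v Y)`. -/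
theorem covDerivEnd_apply {A : Π y : Q, TangentSpace I y →L[ℝ] TangentSpace I y}
    {x : Q} (hA : ∀ Y : Π q : Q, TangentSpace I q, MDiffAt (T% Y) x →
      MDiffAt (T% (fun y => A y (Y y))) x) (v : TangentSpace I x)
    {Y : Π q : Q, TangentSpace I q} (hY : MDiffAt (T% Y) x) :
    covDerivEnd A x v (Y x)
      = leviCivita I Q (fun y => A y (Y y)) x v - A x (leviCivita I Q Y x v) := by
  -- Tensoriality allows `Y` to be replaced by the extension of its value at `x`, the field used
  -- inside `covDerivEnd`.
  have h := (tensorialAt_leviCivita_commutator hA v).pointwise hY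
    (FiberBundle.mdifferentiableAt_extend I E (Y x)) (by simp)
  rw [h]
  simp only [covDerivEnd, covDerivTensor_eq hA]
  exact (Module.finBasis ℝ (TangentSpace I x)).sum_repr _

/-! ### Derivatives on `TQ` along vertical lifts and along sections -/

/-- The affine line `t ↦ v + t w` in a fibre of the tangent bundle is differentiable. -/
theorem mdifferentiableAt_fibre_line (p : TangentBundle I Q) (w : TangentSpace I p.proj) (t : ℝ) :
    MDifferentiableAt 𝓘(ℝ, ℝ) I.tangent
      (fun t : ℝ => (⟨p.proj, p.snd + t • w⟩ : TangentBundle I Q)) t := by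
  rw [mdifferentiableAt_totalSpace]
  refine ⟨mdifferentiableAt_const, ?_⟩
  let e := trivializationAt E (TangentSpace I) p.proj
  have hp : p.proj ∈ e.baseSet := FiberBundle.mem_baseSet_trivializationAt' p.proj
  have h : (fun t : ℝ => (e (⟨p.proj, p.snd + t • w⟩ : TangentBundle I Q)).2)
      = fun t : ℝ => e.linearEquivAt ℝ p.proj hp p.snd + t • e.linearEquivAt ℝ p.proj hp w := by
    funext t
    rw [← map_smul, ← map_add]
    rfl
  change MDifferentiableAt 𝓘(ℝ, ℝ) 𝓘(ℝ, E)
    (fun t : ℝ => (e (⟨p.proj, p.snd + t • w⟩ : TangentBundle I Q)).2) t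
  rw [h]
  exact DifferentiableAt.mdifferentiableAt (by fun_prop)

/-- The derivative of a function on `TQ` along a vertical lift. -/
theorem mvfderiv_verticalLift {h : TangentBundle I Q → ℝ} {p : TangentBundle I Q}
    (hh : MDiffAt h p) (w : TangentSpace I p.proj) :
    mvfderiv I.tangent h p (verticalLift p w)
      = deriv (fun t : ℝ => h ⟨p.proj, p.snd + t • w⟩) 0 := by
  have hp : (⟨p.proj, p.snd + (0 : ℝ) • w⟩ : TangentBundle I Q) = p := by simp
  have h1 := mvfderiv_comp_apply_of_eq (0 : ℝ) (f := fun t : ℝ =>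
    (⟨p.proj, p.snd + t • w⟩ : TangentBundle I Q)) hh (mdifferentiableAt_fibre_line p w 0) hp
    (1 : ℝ)
  refine h1.symm.trans ?_
  rw [mvfderiv, mfderiv_eq_fderiv]
  rfl

/-- The derivative of a function on `TQ` along the lift of a vector by a vector field. -/
theorem mvfderiv_section {h : TangentBundle I Q → ℝ} {p : TangentBundle I Q}
    (hh : MDiffAt h p) {Y : Π q : Q, TangentSpace I q} (hY : MDiffAt (T% Y) p.proj)
    (hp : Y p.proj = p.snd) (w : TangentSpace I p.proj) :
    mvfderiv I.tangent h p
      (mfderiv I I.tangent (fun y => (⟨y, Y y⟩ : TangentBundle I Q)) p.proj w)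
      = mvfderiv I (fun y => h ⟨y, Y y⟩) p.proj w := by
  have hp : (⟨p.proj, Y p.proj⟩ : TangentBundle I Q) = p := by rw [hp]
  exact (mvfderiv_comp_apply_of_eq p.proj (f := fun y => (⟨y, Y y⟩ : TangentBundle I Q))
    hh hY hp w).symm

theorem mvfderiv_inner_self {Y : Π q : Q, TangentSpace I q} {x : Q} (hY : MDiffAt (T% Y) x)
    (v : TangentSpace I x) :
    mvfderiv I (fun y => (inner ℝ (Y y) (Y y) : ℝ)) x v
      = 2 * inner ℝ (Y x) (leviCivita I Q Y x v) := by
  have h := leviCivita_inner (FiberBundle.mdifferentiableAt_extend I E v) hY hY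
  rw [FiberBundle.extend_apply_self] at h
  rw [h, real_inner_comm]
  ring

/-! ### The differential of the candidate and the formula for `ḣ` -/

namespace SMCS
variable {m : ℕ} (S : SMCS I Q m)

theorem inner_projA_projA {q : Q} (v w : TangentSpace I q) :
    (inner ℝ (S.projA q v) (S.projA q w) : ℝ) = inner ℝ (S.projA q v) w := by
  rw [projA, ← Submodule.inner_starProjection_left_eq_right,
    Submodule.starProjection_eq_self_iff.mpr (Submodule.starProjection_apply_mem _ _)]

/-- On the line `v + t w` the candidate is a quadratic polynomial in `t`. Its linear coefficient is
the answer, the projection on `w` being absorbed by `inner_projA_projA`. -/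
theorem mvfderiv_candidate_verticalLift {h₀ : Q → ℝ} (hh₀ : MDiff h₀)
    {κ : Π q : Q, TangentSpace I q} (hκ : MDiff (T% κ)) (ε : ℝ) (p : TangentBundle I Q)
    (w : TangentSpace I p.proj) :
    mvfderiv I.tangent (S.candidate h₀ κ ε) p (verticalLift p w)
      = - ε * inner ℝ (S.projA p.proj (p.snd - κ p.proj)) w := by
  rw [mvfderiv_verticalLift (S.mdifferentiable_candidate hh₀ hκ ε p)]
  have h1 : (fun t : ℝ => S.candidate h₀ κ ε ⟨p.proj, p.snd + t • w⟩) = fun t =>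
      h₀ p.proj - ε / 2 * (‖S.projA p.proj (p.snd - κ p.proj)‖ ^ 2
        + t * (2 * inner ℝ (S.projA p.proj (p.snd - κ p.proj)) w)
        + t ^ 2 * ‖S.projA p.proj w‖ ^ 2) := by
    funext t
    have h2 : p.snd + t • w - κ p.proj = (p.snd - κ p.proj) + t • w := by abel
    rw [candidate, h2, map_add, map_smul, norm_add_sq_real, real_inner_smul_right,
      S.inner_projA_projA, norm_smul, mul_pow, Real.norm_eq_abs, sq_abs]
    ring
  rw [h1]
  generalize (inner ℝ (S.projA p.proj (p.snd - κ p.proj)) w : ℝ) = c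
  generalize ‖S.projA p.proj (p.snd - κ p.proj)‖ ^ 2 = a
  generalize ‖S.projA p.proj w‖ ^ 2 = b
  have h2 : HasDerivAt (fun t : ℝ => h₀ p.proj - ε / 2 * (a + t * (2 * c) + t ^ 2 * b))
      (0 - ε / 2 * (0 + 1 * (2 * c) + (2 * 0 ^ 1 * 1) * b)) 0 := by
    refine (hasDerivAt_const _ _).sub (HasDerivAt.const_mul _ (((hasDerivAt_const _ _).add
      ((hasDerivAt_id _).mul_const _)).add (HasDerivAt.mul_const ?_ _)))
    simpa using (hasDerivAt_id (0 : ℝ)).fun_pow 2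
  rw [h2.deriv]
  ring

/-- Metric compatibility differentiates the squared norm of the field `π_A (Y - κ)`, and
`covDerivEnd_apply` expands its covariant derivative. Pairing with a vector in the range of `π_A`
removes the projection from `∇_v Y - ∇_v κ`. -/
theorem mvfderiv_candidate_section {h₀ : Q → ℝ} (hh₀ : MDiff h₀)
    {κ : Π q : Q, TangentSpace I q} (hκ : MDiff (T% κ)) (ε : ℝ)
    {Y : Π q : Q, TangentSpace I q} {x : Q} (hY : MDiffAt (T% Y) x) (v : TangentSpace I x) :
    mvfderiv I (fun y => S.candidate h₀ κ ε ⟨y, Y y⟩) x v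
      = mvfderiv I h₀ x v - ε * inner ℝ (S.projA x (Y x - κ x))
          (covDerivEnd S.projA x v (Y x - κ x) + leviCivita I Q Y x v - leviCivita I Q κ x v) := by
  have hYκ : MDiffAt (T% (Y - κ)) x := mdifferentiableAt_sub_section hY (hκ x)
  have hP := S.mdifferentiableAt_projA hYκ
  have h1 : (fun y => S.candidate h₀ κ ε ⟨y, Y y⟩) = h₀ - (fun _ => ε / 2) * fun y =>
      (inner ℝ (S.projA y ((Y - κ) y)) (S.projA y ((Y - κ) y)) : ℝ) := by
    funext y
    simp only [candidate, Pi.sub_apply, Pi.mul_apply, real_inner_self_eq_norm_sq]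
  have h2 := covDerivEnd_apply (A := S.projA) (fun _ => S.mdifferentiableAt_projA) v hYκ
  rw [h1, mvfderiv_sub (hh₀ x) (mdifferentiableAt_const.mul (mdiff_inner hP hP)),
    mvfderiv_mul mdifferentiableAt_const (mdiff_inner hP hP), mvfderiv_const]
  simp only [sub_apply, add_apply, smul_apply, zero_apply, smul_eq_mul, mul_zero, add_zero]
  rw [mvfderiv_inner_self hP, eq_add_of_sub_eq h2.symm, leviCivita_sub hY (hκ x)]
  simp only [Pi.sub_apply, sub_apply, inner_add_right, inner_sub_right, S.inner_projA_projA]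
  ring

/-- The derivative of the auxiliary extension of `v` enters once through the section and once, with
opposite sign, through the vertical correction in `horizontalLift`. -/
theorem hDot_eq {h₀ : Q → ℝ} (hh₀ : MDiff h₀)
    {κ : Π q : Q, TangentSpace I q} (hκ : MDiff (T% κ)) (ε : ℝ) (p : TangentBundle I Q)
    (F : S.inputs p.proj) :
    S.hDot h₀ κ ε p F
      = mvfderiv I h₀ p.proj p.snd
        + ε * inner ℝ (S.projA p.proj (p.snd - κ p.proj))
            (leviCivita I Q κ p.proj p.snd + grad S.V p.proj
              - covDerivEnd S.projA p.proj p.snd (p.snd - κ p.proj))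
        - ε * F.1 (S.projA p.proj (p.snd - κ p.proj)) := by
  have hE := FiberBundle.mdifferentiableAt_extend I E p.snd
  have hd := S.mdifferentiable_candidate hh₀ hκ ε p
  -- The horizontal lift is by definition a difference, so linearity of the differential applies
  -- after unfolding.
  have h1 : mvfderiv I.tangent (S.candidate h₀ κ ε) p (horizontalLift p p.snd) = _ :=
    map_sub (mvfderiv I.tangent (S.candidate h₀ κ ε) p) _ _
  rw [mvfderiv_section hd hE (FiberBundle.extend_apply_self ..),
    S.mvfderiv_candidate_verticalLift hh₀ hκ, S.mvfderiv_candidate_section hh₀ hκ ε hE,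
    FiberBundle.extend_apply_self] at h1
  rw [hDot, dynamics, map_add, h1, S.mvfderiv_candidate_verticalLift hh₀ hκ,
    ← inner_sharp F.1, real_inner_comm _ (sharp F.1)]
  simp only [inner_add_right, inner_sub_right, inner_neg_right]
  ring

end SMCS

/-! ### Derivatives along curves in `TQ` -/

/-- A trivialization of the tangent bundle gives a differentiable parametrization `Q × E → TQ`. -/
theorem mdifferentiableAt_trivialization_symm (q : Q) (u : E) :
    MDifferentiableAt (I.prod 𝓘(ℝ, E)) I.tangent
      (fun z : Q × E => (⟨z.1, (trivializationAt E (TangentSpace I) q).symm z.1 z.2⟩ :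
        TangentBundle I Q)) (q, u) := by
  rw [mdifferentiableAt_totalSpace]
  refine ⟨mdifferentiableAt_fst, ?_⟩
  refine MDifferentiableAt.congr_of_eventuallyEq (f := Prod.snd) mdifferentiableAt_snd ?_
  have hq : q ∈ (trivializationAt E (TangentSpace I : Q → Type _) q).baseSet :=
    FiberBundle.mem_baseSet_trivializationAt' q
  filter_upwards [continuous_fst.continuousAt.preimage_mem_nhds
    ((trivializationAt E (TangentSpace I : Q → Type _) q).open_baseSet.mem_nhds hq)] with z hz
  rw [Bundle.Trivialization.apply_mk_symm _ hz]

/-- The derivative of a function on `TQ` along a curve in `TQ`, split in a local trivialization. -/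
theorem hasDerivAt_comp_curve {h : TangentBundle I Q → ℝ} {W : ℝ → TangentBundle I Q} {t : ℝ}
    (hh : MDiffAt h (W t)) (hW : MDifferentiableAt 𝓘(ℝ, ℝ) I.tangent W t) :
    HasDerivAt (fun s => h (W s))
      (mvfderiv I (fun y => h ⟨y, FiberBundle.extend E (W t).snd y⟩) (W t).proj
          (mfderiv 𝓘(ℝ, ℝ) I (fun s => (W s).proj) t (1 : ℝ))
        + mvfderiv I.tangent h (W t) (verticalLift (W t)
            ((trivializationAt E (TangentSpace I) (W t).proj).symm (W t).proj
              (deriv (fun s => (trivializationAt E (TangentSpace I) (W t).proj (W s)).2) t)))) t := by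
  obtain ⟨hγ, hu⟩ := (mdifferentiableAt_totalSpace I W).mp hW
  set p := W t with hp
  set e := trivializationAt E (TangentSpace I) p.proj with he
  have hpe : p.proj ∈ e.baseSet := FiberBundle.mem_baseSet_trivializationAt' p.proj
  set u : ℝ → E := fun s => (e (W s)).2 with hu_def
  replace hu : DifferentiableAt ℝ u t := hu.differentiableAt
  -- `h` read in the trivialization: base point and fibre coordinate become independent variables,
  -- so the derivative is a sum of two partial ones.
  let f : Q × E → ℝ := fun z => h ⟨z.1, e.symm z.1 z.2⟩
  have hsymm : e.symm p.proj (e p).2 = p.snd := by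
    simpa using e.symm_apply_apply_mk hpe p.snd
  have hf : MDifferentiableAt (I.prod 𝓘(ℝ, E)) 𝓘(ℝ, ℝ) f (p.proj, u t) := by
    refine MDifferentiableAt.comp_of_eq (p.proj, u t) (f := fun z : Q × E =>
      (⟨z.1, e.symm z.1 z.2⟩ : TangentBundle I Q)) hh
      (mdifferentiableAt_trivialization_symm p.proj (u t)) ?_
    simp only [hu_def, ← hp, hsymm]
  have hg : MDifferentiableAt 𝓘(ℝ, ℝ) (I.prod 𝓘(ℝ, E)) (fun s => ((W s).proj, u s)) t :=
    hγ.prodMk hu.mdifferentiableAt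
  have hcongr : (fun s => h (W s)) =ᶠ[𝓝 t] fun s => f ((W s).proj, u s) := by
    filter_upwards [hγ.continuousAt.preimage_mem_nhds (e.open_baseSet.mem_nhds hpe)] with s hs
    have : e.symm (W s).proj (e (W s)).2 = (W s).snd := by
      simpa using e.symm_apply_apply_mk hs (W s).snd
    simp only [f, hu_def, this]
  have hfg : MDifferentiableAt 𝓘(ℝ, ℝ) 𝓘(ℝ, ℝ) (fun s => f ((W s).proj, u s)) t :=
    MDifferentiableAt.comp (g := f) t hf hg
  have hd := hfg.differentiableAt.hasDerivAt.congr_of_eventuallyEq hcongr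
  have h1 := mvfderiv_comp_apply t (f := fun s => ((W s).proj, u s)) hf hg (1 : ℝ)
  have h2 : deriv (fun s => f ((W s).proj, u s)) t
      = mvfderiv 𝓘(ℝ, ℝ) (f ∘ fun s => ((W s).proj, u s)) t (1 : ℝ) := by
    rw [mvfderiv, mfderiv_eq_fderiv]
    rfl
  have h3 : mvfderiv (I.prod 𝓘(ℝ, E)) f (p.proj, u t)
      (mfderiv 𝓘(ℝ, ℝ) (I.prod 𝓘(ℝ, E)) (fun s => ((W s).proj, u s)) t (1 : ℝ))
      = mvfderiv I (fun y => f (y, u t)) p.proj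
          (mfderiv 𝓘(ℝ, ℝ) I (fun s => (W s).proj) t (1 : ℝ))
        + fderiv ℝ (fun z => f (p.proj, z)) (u t) (deriv u t) := by
    refine (mfderiv_prod_eq_add_apply hf).trans ?_
    rw [mfderiv_prodMk hγ hu.mdifferentiableAt, mfderiv_eq_fderiv, mfderiv_eq_fderiv]
    rfl
  have hfq : DifferentiableAt ℝ (fun z => f (p.proj, z)) (u t) := by
    have h : MDifferentiableAt 𝓘(ℝ, E) 𝓘(ℝ, ℝ) (fun z => f (p.proj, z)) (u t) :=
      MDifferentiableAt.comp (g := f) (u t) hf (mdifferentiableAt_const.prodMk mdifferentiableAt_id)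
    exact h.differentiableAt
  -- The trivialization is linear on the fibre, so the line defining the vertical lift is a line in
  -- `E`, and the fibre partial derivative is the derivative along that lift.
  have h4 : (fun r : ℝ => h ⟨p.proj, p.snd + r • e.symm p.proj (deriv u t)⟩)
      = fun r : ℝ => f (p.proj, u t + r • deriv u t) := by
    funext r
    have : e.symm p.proj (u t + r • deriv u t) = p.snd + r • e.symm p.proj (deriv u t) := by
      rw [← hsymm, ← e.coe_symmₗ (R := ℝ) hpe, map_add, map_smul]
    simp only [f, this]
  have h5 : HasDerivAt (fun r : ℝ => f (p.proj, u t + r • deriv u t))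
      (fderiv ℝ (fun z => f (p.proj, z)) (u t) (deriv u t)) 0 := by
    have h := hfq.hasFDerivAt.hasLineDerivAt (deriv u t)
    exact h
  refine hd.congr_deriv ?_
  rw [h2, h1, h3, mvfderiv_verticalLift hh, h4, h5.deriv]
  -- Freezing the fibre coordinate at `u t` gives precisely the local field `FiberBundle.extend`,
  -- whose coordinate in this trivialization is constant.
  simp only [f, hu_def, FiberBundle.extend, he, ← hp]

namespace SMCS
variable {m : ℕ} (S : SMCS I Q m)

/-- Along a solution of the equations of motion the candidate has derivative `ḣ`. -/
theorem hasDerivAt_candidate_velocity {h₀ : Q → ℝ} (hh₀ : MDiff h₀)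
    {κ : Π q : Q, TangentSpace I q} (hκ : MDiff (T% κ)) (ε : ℝ) {F : S.ControlForce} {γ : ℝ → Q}
    {J : Set ℝ} (hγ : S.IsSolutionOn F γ J) {t : ℝ} (ht : t ∈ J) :
    HasDerivAt (fun s => S.candidate h₀ κ ε (velocity I γ s))
      (S.hDot h₀ κ ε (velocity I γ t) (F (velocity I γ t))) t := by
  have hd := S.mdifferentiable_candidate hh₀ hκ ε (velocity I γ t)
  refine (hasDerivAt_comp_curve hd (hγ.mdifferentiableAt_velocity t ht)).congr_deriv ?_
  have hE := FiberBundle.mdifferentiableAt_extend I E (velocity I γ t).snd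
  have h1 : mvfderiv I.tangent (S.candidate h₀ κ ε) (velocity I γ t)
      (horizontalLift (velocity I γ t) (velocity I γ t).snd) = _ :=
    map_sub (mvfderiv I.tangent (S.candidate h₀ κ ε) (velocity I γ t)) _ _
  rw [mvfderiv_section hd hE (FiberBundle.extend_apply_self ..),
    S.mvfderiv_candidate_verticalLift hh₀ hκ] at h1
  have h2 : (trivializationAt E (TangentSpace I) (velocity I γ t).proj).symm (velocity I γ t).proj
        (deriv (fun s => (trivializationAt E (TangentSpace I) (velocity I γ t).proj
          (velocity I γ s)).2) t)
      + leviCivita I Q (FiberBundle.extend E (velocity I γ t).snd) (velocity I γ t).proj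
          (velocity I γ t).snd
      = - grad S.V (velocity I γ t).proj + sharp (F (velocity I γ t)).1 := hγ.eom t ht
  have h3 : mfderiv 𝓘(ℝ, ℝ) I (fun s => (velocity I γ s).proj) t (1 : ℝ) = (velocity I γ t).snd :=
    rfl
  -- Substituting the equations of motion backwards replaces `-grad V + F♯` by the coordinate
  -- derivative plus `∇_v` of the extension; the latter cancels against the correction in the
  -- horizontal lift.
  rw [hDot, dynamics, map_add, h1, S.mvfderiv_candidate_verticalLift hh₀ hκ,
    S.mvfderiv_candidate_verticalLift hh₀ hκ, ← h2, inner_add_right, h3]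
  ring

end SMCS

end
end GeoMech

end

open GeoMech

/-! ### The theorem -/

theorem mainTheorem7 {n m : ℕ}
    {Q : Type*} [TopologicalSpace Q] [T2Space Q] [SecondCountableTopology Q]
    [ChartedSpace (EuclideanSpace ℝ (Fin n)) Q] [IsManifold (𝓡 n) ∞ Q]
    [RiemannianBundle (fun q : Q => TangentSpace (𝓡 n) q)]
    [IsContMDiffRiemannianBundle (𝓡 n) ∞ (EuclideanSpace ℝ (Fin n))
      (fun q : Q => TangentSpace (𝓡 n) q)]
    (S : SMCS (𝓡 n) Q m)
    (h₀ : Q → ℝ) (hh₀ : ContMDiff (𝓡 n) 𝓘(ℝ, ℝ) ∞ h₀)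
    (κ : Π q : Q, TangentSpace (𝓡 n) q)
    (hκ : ContMDiff (𝓡 n) (𝓡 n).tangent ∞ (fun q => (⟨q, κ q⟩ : TangentBundle (𝓡 n) Q)))
    (ε : ℝ) (hε : 0 < ε) :
    MDifferentiable (𝓡 n).tangent 𝓘(ℝ, ℝ) (S.candidate h₀ κ ε) ∧
    (∀ (q : Q) (v : TangentSpace (𝓡 n) q) (F : S.inputs q),
      S.hDot h₀ κ ε ⟨q, v⟩ F
        = mvfderiv (𝓡 n) h₀ q v
          + ε * inner ℝ (S.projA q (v - κ q))
              (leviCivita (𝓡 n) Q κ q v + grad S.V q - covDerivEnd S.projA q v (v - κ q))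
          - ε * F.1 (S.projA q (v - κ q))) ∧
    (∀ (F : S.ControlForce) (γ : ℝ → Q) (J : Set ℝ), IsOpen J → S.IsSolutionOn F γ J →
      ∀ t ∈ J, HasDerivAt (fun s => S.candidate h₀ κ ε (velocity (𝓡 n) γ s))
        (S.hDot h₀ κ ε (velocity (𝓡 n) γ t) (F (velocity (𝓡 n) γ t))) t) ∧
    (∀ (q : Q) (v : TangentSpace (𝓡 n) q), ∃ A : S.inputs q →ᵃ[ℝ] ℝ,
      ∀ F : S.inputs q, S.hDot h₀ κ ε ⟨q, v⟩ F = A F ∧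
        A.linear F = - ε * F.1 (S.projA q (v - κ q))) := by
  have hh : MDifferentiable (𝓡 n) 𝓘(ℝ, ℝ) h₀ := hh₀.mdifferentiable (by simp)
  have hk : MDifferentiable (𝓡 n) (𝓡 n).tangent
      (fun q => (⟨q, κ q⟩ : TangentBundle (𝓡 n) Q)) := hκ.mdifferentiable (by simp)
  have hformula := fun (q : Q) (v : TangentSpace (𝓡 n) q) (F : S.inputs q) =>
    S.hDot_eq hh hk ε ⟨q, v⟩ F
  refine ⟨S.mdifferentiable_candidate hh hk ε, hformula,
    fun F γ J _ hγ t ht => S.hasDerivAt_candidate_velocity hh hk ε hγ ht, fun q v => ?_⟩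
  let L : S.inputs q →ₗ[ℝ] ℝ :=
    { toFun := fun F => - ε * F.1 (S.projA q (v - κ q))
      map_add' := fun F G => by
        simp only [Submodule.coe_add, add_apply]
        ring
      map_smul' := fun c F => by
        simp only [Submodule.coe_smul, smul_apply, smul_eq_mul, RingHom.id_apply]
        ring }
  -- The affine map is `ḣ` itself with linear part `L`; the remaining identity holds because only
  -- the last term of the formula involves the force.
  refine ⟨⟨fun F => S.hDot h₀ κ ε ⟨q, v⟩ F, L, fun F G => ?_⟩, fun F => ⟨rfl, rfl⟩⟩
  rw [hformula, hformula]
  simp only [L, LinearMap.coe_mk, AddHom.coe_mk, vadd_eq_add, Submodule.coe_add, add_apply]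
  ring
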